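/- Let $\alpha > -1/2$, and let $f\colon [0,\infty)\to\mathbb{R}$ be continuous and satisfy $|f(x)| \le C(1+|x|)^{-\alpha-1-\varepsilon}$ for all $x \ge 0$, for some constants $C>0$ and $\varepsilon>0$. For $j \ge 0$ let $L_j^\alpha$ be the Laguerre polynomial of degree $j$ and parameter $\alpha$, $$ L_j^\alpha(x)=\sum_{i=0}^{j}(-1)^i\binom{j+\alpha}{j-i}\frac{x^i}{i!}, $$ and let $J_\alpha(x)=\sum_{m\ge 0}\frac{(-1)^m}{m!\,\Gamma(m+\alpha+1)}\left(\frac{x}{2}\right)^{2m+\alpha}$ be the Bessel function of the first kind. A function $f\colon [0,\infty)\to\mathbb{R}$ has the $\alpha$-SILP property ("scale-invariant Laguerre positivity") if it is continuous, satisfies a bound $|f(x)| \le C(1+|x|)^{-\alpha-1-\varepsilon}$ for some $C,\varepsilon>0$, and for every $y>0$ and every $j\ge 0$ the Laguerre coefficient $$ a_j(y)=\frac{\int_0^\infty f(x/y)\,L_j^\alpha(x)\,x^\alpha e^{-x}\,dx}{\int_0^\infty L_j^\alpha(x)^2\,x^\alpha e^{-x}\,dx} $$ of the function $x\mapsto f(x/y)$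 is non-negative. Then $f$ has the $\alpha$-SILP property if and only if there is a weakly increasing function $g\colon[0,\infty)\to\mathbb{R}$ such that, for every $x\ge 0$, the following Stieltjes integral converges (absolutely) and $$ f(x)=\int_0^\infty (xy)^{-\alpha/2}J_\alpha\bigl(2\sqrt{xy}\bigr)\,dg(y), $$ where $t^{-\alpha/2}J_\alpha(2\sqrt t)$ is given its limiting value $1/\Gamma(\alpha+1)$ at $t=0$, and a jump $g(0+)-g(0)$ of $g$ at $0$ counts as a point mass of $dg$ at $0$. -/

import Mathlib

noncomputable section

namespace SILP

/-- The generalized Laguerre polynomial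
`L_k^α(x) = ∑_{i ≤ k} (-1)^i * binom(k + α, k - i) * x^i / i!` for `α > -1`, the binomial coefficient
being written as `Γ(k + α + 1) / ((k - i)! Γ(i + α + 1))`. -/
def laguerre (α : ℝ) (k : ℕ) (x : ℝ) : ℝ :=
  ∑ i ∈ Finset.range (k + 1),
    (-1) ^ i * (Real.Gamma (k + α + 1) / ((k - i).factorial * Real.Gamma (i + α + 1))) *
      (x ^ i / i.factorial)

/-- The Bessel function of the first kind,
`J_α(x) = ∑_{m ≥ 0} (-1)^m / (m! Γ(m + α + 1)) * (x / 2)^(2 m + α)`, for `α > -1` and `x ≥ 0`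
(`x > 0` if `α < 0`). -/
def besselJ (α x : ℝ) : ℝ :=
  ∑' m : ℕ, (-1) ^ m / (m.factorial * Real.Gamma (m + α + 1)) * (x / 2) ^ (2 * m + α)

/-- The function `t ↦ t^(-α/2) J_α(2 √t)` on `[0, ∞)`, with its limit `1 / Γ(α + 1)` as the value
at `t = 0`, where the expression itself is not defined. -/
def besselKernel (α t : ℝ) : ℝ :=
  if t = 0 then 1 / Real.Gamma (α + 1) else t ^ (-α / 2) * besselJ α (2 * √t)

/-- The `j`-th coefficient of the Laguerre series `∑ a_j L_j^α` of a function `h` on `[0, ∞)`. -/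
def laguerreCoeff (α : ℝ) (h : ℝ → ℝ) (j : ℕ) : ℝ :=
  (∫ x in Set.Ioi (0 : ℝ), h x * laguerre α j x * x ^ α * Real.exp (-x)) /
    ∫ x in Set.Ioi (0 : ℝ), laguerre α j x ^ 2 * x ^ α * Real.exp (-x)

/-- Continuity on `[0, ∞)` and the bound `|f(x)| ≤ C (1 + |x|)^(-α-1-ε)` there, for some
`C, ε > 0`. -/
def ContinuousDecay (α : ℝ) (f : ℝ → ℝ) : Prop :=
  ContinuousOn f (Set.Ici 0) ∧
    ∃ ε : ℝ, 0 < ε ∧ ∃ C : ℝ, 0 < C ∧ ∀ x, 0 ≤ x → |f x| ≤ C * (1 + |x|) ^ (-α - 1 - ε)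

/-- The `α`-SILP property of a function on `[0, ∞)`, given as the restriction of `f : ℝ → ℝ`. -/
def HasSILP (α : ℝ) (f : ℝ → ℝ) : Prop :=
  ContinuousDecay α f ∧
    ∀ y, 0 < y → ∀ j : ℕ, 0 ≤ laguerreCoeff α (fun x => f (x / y)) j

theorem monotone_comp_max {g : ℝ → ℝ} (hg : MonotoneOn g (Set.Ici 0)) :
    Monotone fun y => g (max y 0) :=
  fun _ _ hab => hg (Set.mem_Ici.2 (le_max_right _ _)) (Set.mem_Ici.2 (le_max_right _ _)) (
    max_le_max_right 0 hab)

/-- The Lebesgue–Stieltjes measure `dg` of a weakly increasing function `g` on `[0, ∞)`: `g` is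
extended by the constant `g 0` to the left of `0`, so that `dg` lives on `[0, ∞)`, gives `{0}` the mass
`g(0+) - g(0)`, and gives `(a, b]` the mass `g(b+) - g(a+)`. -/
def stieltjesMeasure {g : ℝ → ℝ} (hg : MonotoneOn g (Set.Ici 0)) : MeasureTheory.Measure ℝ :=
  (monotone_comp_max hg).stieltjesFunction.measure

end SILP

end

/-!
Let `Λ_α(t) = t ^ (-α / 2) * J_α(2 √t)`, and let `H` be the Hankel transform with kernel
`Λ_α(x s)` for the measure `x ^ α dx` on `(0, ∞)`. For `-1 / 2 ≤ α` the energy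
`Λ_α(t) ^ 2 + t * Λ_{α+1}(t) ^ 2` is decreasing in `t`, so that `|Λ_α| ≤ Λ_α(0)` on `[0, ∞)`, and
Fubini makes `H` symmetric. Up to positive factors, `H` interchanges `L_j^α(x / r) * exp (-x / r)`
and `s ^ j * exp (-r s)`. The first family produces the Laguerre coefficients of the dilations of
`f`, so these are, up to positive factors, the integrals of `H f` against the second family. The
latter concentrates at `j / r` as `j → ∞` with `j / r` fixed, hence all coefficients are nonnegative
if and only if `H f` is. In that case the integrals with `j = 0` and Fatou's lemma show that `H f`
is integrable. Then `H (H f)` and `f` have the same integrals against the second family, so they are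
equal, and `g` can be taken with `dg(s) = (H f)(s) s ^ α ds`. Conversely, if `f` is the Hankel
transform of a finite measure, then by Fubini its Laguerre coefficients are integrals of nonnegative
functions.
-/

noncomputable section

namespace SILP

open Real Set MeasureTheory Filter Topology fwdDiff

/-- The exponential generating function `∑ m, c m * t ^ m / m!` of a sequence. In this form of
a power series, differentiation is a shift of `c` and multiplication by `exp t` is binomial
summation. -/
def expGenFun (c : ℕ → ℝ) (t : ℝ) : ℝ :=
  ∑' m : ℕ, c m * (t ^ m / m.factorial)

section ExpGenFun

variable {c : ℕ → ℝ} {K : ℝ}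

theorem summable_norm_expGenFun (hc : ∀ m, |c m| ≤ K) (t : ℝ) :
    Summable fun m : ℕ => ‖c m * (t ^ m / m.factorial)‖ := by
  refine .of_nonneg_of_le (fun _ => norm_nonneg _) (fun m => ?_)
    ((summable_pow_div_factorial t).norm.mul_left K)
  rw [norm_mul]
  gcongr
  exact hc m

theorem hasSum_expGenFun (hc : ∀ m, |c m| ≤ K) (t : ℝ) :
    HasSum (fun m : ℕ => c m * (t ^ m / m.factorial)) (expGenFun c t) :=
  (summable_norm_expGenFun hc t).of_norm.hasSum

theorem expGenFun_zero (c : ℕ → ℝ) : expGenFun c 0 = c 0 := by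
  rw [expGenFun, tsum_eq_single 0 fun m hm => by simp [hm]]
  simp

theorem hasSum_natCast_mul_expGenFun (hc : ∀ m, |c m| ≤ K) (t : ℝ) :
    HasSum (fun m : ℕ => m * c m * (t ^ m / m.factorial))
      (t * expGenFun (fun m => c (m + 1)) t) := by
  rw [← hasSum_nat_add_iff' 1]
  simp only [Finset.range_one, Finset.sum_singleton, Nat.cast_zero, zero_mul, sub_zero]
  refine ((hasSum_expGenFun (fun m => hc (m + 1)) t).mul_left t).congr_fun fun m => ?_
  rw [Nat.factorial_succ]
  push_cast
  field_simp
  ring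

theorem hasDerivAt_pow_succ_div_factorial (m : ℕ) (t : ℝ) :
    HasDerivAt (fun t : ℝ => t ^ (m + 1) / (m + 1).factorial) (t ^ m / m.factorial) t := by
  refine ((hasDerivAt_pow (m + 1) t).div_const _).congr_deriv ?_
  rw [Nat.factorial_succ, Nat.add_sub_cancel]
  push_cast
  field_simp

theorem hasDerivAt_expGenFun (hc : ∀ m, |c m| ≤ K) (t : ℝ) :
    HasDerivAt (expGenFun c) (expGenFun (fun m => c (m + 1)) t) t := by
  set R : ℝ := |t| + 1
  have hshift : expGenFun c =
      fun t => c 0 + ∑' m : ℕ, c (m + 1) * (t ^ (m + 1) / (m + 1).factorial) := by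
    ext t
    rw [expGenFun, (hasSum_expGenFun hc t).summable.tsum_eq_zero_add]
    simp
  rw [hshift]
  refine (hasDerivAt_tsum_of_isPreconnected (t := Metric.ball 0 R) (y₀ := 0)
    ((summable_pow_div_factorial R).mul_left K) Metric.isOpen_ball
    (convex_ball 0 R).isPreconnected
    (fun m s _ => (hasDerivAt_pow_succ_div_factorial m s).const_mul (c (m + 1)))
    (fun m s hs => ?_) (Metric.mem_ball_self (by positivity)) (by simp [summable_zero])
    (by simp [R])).const_add (c 0)
  have hs' : |s| ≤ R := by simpa using (Metric.mem_ball.1 hs).le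
  rw [norm_mul, norm_div, norm_pow, norm_natCast]
  simp only [norm_eq_abs]
  gcongr
  exacts [(abs_nonneg _).trans (hc 0), hc (m + 1)]

end ExpGenFun

theorem Gamma_natCast_add_pos {α : ℝ} (hα : -1 < α) (m : ℕ) : 0 < Gamma (m + α + 1) :=
  Gamma_pos_of_pos (by have := m.cast_nonneg (α := ℝ); linarith)

theorem Gamma_natCast_add_succ {α : ℝ} (hα : -1 < α) (m : ℕ) :
    Gamma ((m + 1 : ℕ) + α + 1) = (m + α + 1) * Gamma (m + α + 1) := by
  have := m.cast_nonneg (α := ℝ)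
  rw [← Gamma_add_one (by linarith)]
  push_cast
  ring_nf

/-- The Taylor coefficients of `besselSeries α`, without the factor `1 / m!`. -/
def besselCoeff (α : ℝ) (m : ℕ) : ℝ :=
  (-1) ^ m / Gamma (m + α + 1)

/-- The entire function `Λ_α(t) = t ^ (-α / 2) * J_α(2 √t) = ∑ m, (-t) ^ m / (m! Γ(m + α + 1))`,
which agrees with `besselKernel α` for `0 ≤ t`. -/
def besselSeries (α : ℝ) : ℝ → ℝ :=
  expGenFun (besselCoeff α)

section BesselSeries

variable {α : ℝ}

theorem besselCoeff_succ (α : ℝ) (m : ℕ) : besselCoeff α (m + 1) = -besselCoeff (α + 1) m := by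
  rw [besselCoeff, besselCoeff, pow_succ, Nat.cast_succ,
    show (m : ℝ) + 1 + α + 1 = m + (α + 1) + 1 by ring]
  ring

theorem besselCoeff_eq_mul (hα : -1 < α) (m : ℕ) :
    besselCoeff α m = (m + α + 1) * besselCoeff (α + 1) m := by
  have : (m : ℝ) + α + 1 ≠ 0 := by
    have := m.cast_nonneg (α := ℝ)
    linarith
  rw [besselCoeff, besselCoeff,
    show (m : ℝ) + (α + 1) + 1 = (m + 1 : ℕ) + α + 1 by push_cast; ring, Gamma_natCast_add_succ hα]
  field_simp

theorem abs_besselCoeff (hα : -1 < α) (m : ℕ) :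
    |besselCoeff α m| = (Gamma (m + α + 1))⁻¹ := by
  rw [besselCoeff, abs_div, abs_neg_one_pow, abs_of_pos (Gamma_natCast_add_pos hα m), one_div]

theorem exists_abs_besselCoeff_le (hα : -1 < α) : ∃ K, ∀ m, |besselCoeff α m| ≤ K := by
  have hanti : Antitone fun m => |besselCoeff α (m + 1)| := antitone_nat_of_succ_le fun m => by
    have := m.cast_nonneg (α := ℝ)
    rw [besselCoeff_succ α (m + 1), abs_neg, besselCoeff_eq_mul hα, abs_mul]
    push_cast
    exact le_mul_of_one_le_left (abs_nonneg _) (le_abs.2 (.inl (by linarith)))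
  refine ⟨max |besselCoeff α 0| |besselCoeff α 1|, fun m => ?_⟩
  cases m with
  | zero => exact le_max_left _ _
  | succ m => exact (hanti m.zero_le).trans (le_max_right _ _)

theorem hasSum_besselSeries (hα : -1 < α) (t : ℝ) :
    HasSum (fun m : ℕ => besselCoeff α m * (t ^ m / m.factorial)) (besselSeries α t) :=
  let ⟨_, hK⟩ := exists_abs_besselCoeff_le hα
  hasSum_expGenFun hK t

theorem besselSeries_zero (α : ℝ) : besselSeries α 0 = 1 / Gamma (α + 1) := by
  simp [besselSeries, expGenFun_zero, besselCoeff]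

theorem expGenFun_besselCoeff_succ (α t : ℝ) :
    expGenFun (fun m => besselCoeff α (m + 1)) t = -besselSeries (α + 1) t := by
  simp only [besselSeries, expGenFun, besselCoeff_succ, neg_mul, tsum_neg]

theorem hasDerivAt_besselSeries (hα : -1 < α) (t : ℝ) :
    HasDerivAt (besselSeries α) (-besselSeries (α + 1) t) t := by
  obtain ⟨K, hK⟩ := exists_abs_besselCoeff_le hα
  exact (hasDerivAt_expGenFun hK t).congr_deriv (expGenFun_besselCoeff_succ α t)

theorem continuous_besselSeries (hα : -1 < α) : Continuous (besselSeries α) :=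
  continuous_iff_continuousAt.2 fun t => (hasDerivAt_besselSeries hα t).continuousAt

theorem besselSeries_recurrence (hα : -1 < α) (t : ℝ) :
    besselSeries α t = (α + 1) * besselSeries (α + 1) t - t * besselSeries (α + 2) t := by
  have hα₁ : -1 < α + 1 := by linarith
  obtain ⟨K, hK⟩ := exists_abs_besselCoeff_le hα₁
  have hsum := ((hasSum_besselSeries hα₁ t).mul_left (α + 1)).add
    (hasSum_natCast_mul_expGenFun hK t)
  rw [expGenFun_besselCoeff_succ, show α + 1 + 1 = α + 2 by ring, mul_neg, ← sub_eq_add_neg] at hsum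
  refine (hasSum_besselSeries hα t).unique (hsum.congr_fun fun m => ?_)
  rw [besselCoeff_eq_mul hα]
  ring

theorem antitoneOn_besselSeries_energy (hα : -1 / 2 ≤ α) :
    AntitoneOn (fun t => besselSeries α t ^ 2 + t * besselSeries (α + 1) t ^ 2) (Ici 0) := by
  have hderiv (t : ℝ) : HasDerivAt (fun t => besselSeries α t ^ 2 + t * besselSeries (α + 1) t ^ 2)
      (-(2 * α + 1) * besselSeries (α + 1) t ^ 2) t := by
    have hα₀ : -1 < α := by linarith
    have hrec := besselSeries_recurrence hα₀ t
    have h₀ := (hasDerivAt_besselSeries hα₀ t).pow 2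
    have h₁ := (hasDerivAt_besselSeries (show -1 < α + 1 by linarith) t).pow 2
    rw [show α + 1 + 1 = α + 2 by ring] at h₁
    refine (h₀.add ((hasDerivAt_id t).mul h₁)).congr_deriv ?_
    simp only [id, Pi.pow_apply]
    push_cast
    linear_combination (-2 * besselSeries (α + 1) t) * hrec
  refine antitoneOn_of_hasDerivWithinAt_nonpos (convex_Ici 0)
    (fun t _ => (hderiv t).continuousAt.continuousWithinAt)
    (fun t _ => (hderiv t).hasDerivWithinAt) fun t _ => ?_
  exact mul_nonpos_of_nonpos_of_nonneg (by linarith) (sq_nonneg _)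

theorem abs_besselSeries_le (hα : -1 / 2 ≤ α) {t : ℝ} (ht : 0 ≤ t) :
    |besselSeries α t| ≤ 1 / Gamma (α + 1) := by
  have henergy := antitoneOn_besselSeries_energy hα self_mem_Ici ht ht
  simp only [zero_mul, add_zero] at henergy
  have hsq : besselSeries α t ^ 2 ≤ besselSeries α 0 ^ 2 :=
    (le_add_of_nonneg_right (mul_nonneg ht (sq_nonneg _))).trans henergy
  rw [besselSeries_zero] at hsq
  exact abs_le_of_sq_le_sq hsq (one_div_pos.2 (Gamma_pos_of_pos (by linarith))).le

theorem besselKernel_eq_besselSeries {t : ℝ} (ht : 0 ≤ t) :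
    besselKernel α t = besselSeries α t := by
  rcases ht.eq_or_lt with rfl | ht
  · rw [besselSeries_zero, besselKernel, if_pos rfl]
  rw [besselKernel, if_neg ht.ne', besselJ, besselSeries, expGenFun, ← tsum_mul_left]
  refine tsum_congr fun m => ?_
  have hpow : t ^ (-α / 2) * (2 * √t / 2) ^ (2 * (m : ℝ) + α) = t ^ m := by
    rw [mul_div_cancel_left₀ _ two_ne_zero, sqrt_eq_rpow, ← rpow_mul ht.le, ← rpow_add ht,
      ← rpow_natCast]
    congr 1
    ring
  rw [mul_left_comm, hpow, besselCoeff]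
  ring

end BesselSeries

theorem expGenFun_one (z : ℝ) : expGenFun (fun _ => 1) z = exp z := by
  simp only [expGenFun, one_mul, exp_eq_exp_ℝ, NormedSpace.exp_eq_tsum_div]

/-- Newton's formula `a m = ∑ (m choose k) Δᵏ a 0`, read as a Cauchy product with `exp z`. -/
theorem hasSum_expGenFun_of_fwdDiff {a : ℕ → ℝ} {z : ℝ}
    (ha : Summable fun k : ℕ => ‖Δ_[1] ^[k] a 0 * (z ^ k / k.factorial)‖) :
    HasSum (fun m : ℕ => a m * (z ^ m / m.factorial))
      (expGenFun (fun k => Δ_[1] ^[k] a 0) z * exp z) := by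
  have hprod := hasSum_sum_range_mul_of_summable_norm ha
    (summable_norm_expGenFun (c := fun _ => 1) (fun _ => abs_one.le) z)
  rw [← expGenFun, ← expGenFun, expGenFun_one] at hprod
  refine hprod.congr_fun fun m => ?_
  have hnewton := shift_eq_sum_fwdDiff_iter 1 a m 0
  rw [zero_add, smul_eq_mul, mul_one] at hnewton
  rw [hnewton, Finset.sum_mul]
  refine Finset.sum_congr rfl fun k hk => ?_
  have hkm : k ≤ m := Nat.lt_succ_iff.1 (Finset.mem_range.1 hk)
  rw [nsmul_eq_mul, Nat.cast_choose ℝ hkm, ← pow_mul_pow_sub z hkm]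
  field_simp

section Laguerre

variable {α : ℝ}

/-- The quotient `Γ(m + j + α + 1) / Γ(m + i + α + 1)`, which for `i ≤ j` is a polynomial in `m` of
degree `j - i`. The iterated differences of `gammaRatio α j 0` at `0` are, up to signs and
factorials, the coefficients of `L_j^α`. -/
def gammaRatio (α : ℝ) (j i m : ℕ) : ℝ :=
  Gamma ((m + j : ℕ) + α + 1) / Gamma ((m + i : ℕ) + α + 1)

theorem fwdDiff_gammaRatio (hα : -1 < α) (j i m : ℕ) :
    Δ_[1] (gammaRatio α j i) m = (j - i) * gammaRatio α j (i + 1) m := by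
  have hΓ := (Gamma_natCast_add_pos hα (m + i)).ne'
  have hm : ((m + i : ℕ) : ℝ) + α + 1 ≠ 0 := by
    have := (m + i).cast_nonneg (α := ℝ)
    linarith
  rw [fwdDiff, gammaRatio, gammaRatio, gammaRatio, Nat.add_right_comm m 1 j,
    Nat.add_right_comm m 1 i, ← Nat.add_assoc m i 1, Gamma_natCast_add_succ hα,
    Gamma_natCast_add_succ hα]
  field_simp
  push_cast
  ring

theorem fwdDiff_iter_gammaRatio (hα : -1 < α) (j i m : ℕ) :
    Δ_[1] ^[i] (gammaRatio α j 0) m = j.descFactorial i * gammaRatio α j i m := by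
  induction i generalizing m with
  | zero => simp
  | succ i ih =>
    have hdiff : Δ_[1] ^[i] (gammaRatio α j 0) = (j.descFactorial i : ℝ) • gammaRatio α j i :=
      funext ih
    rw [Function.iterate_succ_apply', hdiff, fwdDiff_const_smul, Pi.smul_apply, smul_eq_mul,
      fwdDiff_gammaRatio hα, Nat.descFactorial_succ, Nat.cast_mul]
    rcases le_or_gt i j with hij | hij
    · rw [Nat.cast_sub hij]
      ring
    · simp [Nat.descFactorial_of_lt hij]

theorem hasSum_fwdDiff_gammaRatio (hα : -1 < α) (j : ℕ) (z : ℝ) :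
    HasSum (fun k : ℕ => Δ_[1] ^[k] (gammaRatio α j 0) 0 * (z ^ k / k.factorial))
      (j.factorial * laguerre α j (-z)) := by
  rw [laguerre, Finset.mul_sum]
  have hterm : ∀ k ∈ Finset.range (j + 1),
      Δ_[1] ^[k] (gammaRatio α j 0) 0 * (z ^ k / k.factorial) =
      j.factorial * ((-1) ^ k * (Gamma (j + α + 1) / ((j - k).factorial * Gamma (k + α + 1))) *
        ((-z) ^ k / k.factorial)) := by
    intro k hk
    have hz : z ^ k = (-1) ^ k * (-z) ^ k := by rw [← mul_pow, neg_one_mul, neg_neg]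
    rw [fwdDiff_iter_gammaRatio hα, gammaRatio, zero_add, zero_add, hz,
      ← Nat.factorial_mul_descFactorial (Nat.lt_succ_iff.1 (Finset.mem_range.1 hk))]
    push_cast
    field_simp
  rw [← Finset.sum_congr rfl hterm]
  refine hasSum_sum_of_ne_finset_zero fun k hk => ?_
  rw [fwdDiff_iter_gammaRatio hα, Nat.descFactorial_of_lt (by simpa using hk)]
  simp

theorem hasSum_gammaRatio (hα : -1 < α) (j : ℕ) (z : ℝ) :
    HasSum (fun m : ℕ => gammaRatio α j 0 m * (z ^ m / m.factorial))
      (j.factorial * laguerre α j (-z) * exp z) := by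
  have hΔ := hasSum_fwdDiff_gammaRatio hα j z
  have := hasSum_expGenFun_of_fwdDiff hΔ.summable.norm
  rwa [expGenFun, hΔ.tsum_eq] at this

theorem fwdDiff_iter_pow_div_Gamma (hα : -1 < α) (i : ℕ) (x : ℝ) :
    Δ_[1] ^[i] (fun k : ℕ => x ^ k / Gamma (k + α + 1)) 0 =
      (-1) ^ i * i.factorial / Gamma (i + α + 1) * laguerre α i x := by
  have hΓ := (Gamma_natCast_add_pos hα i).ne'
  rw [fwdDiff_iter_eq_sum_shift, laguerre, Finset.mul_sum]
  refine Finset.sum_congr rfl fun k hk => ?_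
  have hki : k ≤ i := Nat.lt_succ_iff.1 (Finset.mem_range.1 hk)
  have hsign : (-1 : ℝ) ^ i * (-1) ^ k = (-1) ^ (i - k) := by
    rw [← Nat.sub_add_cancel hki, pow_add, mul_assoc, ← pow_add, Even.neg_one_pow ⟨k, rfl⟩, mul_one,
      Nat.add_sub_cancel]
  rw [zsmul_eq_mul, zero_add, smul_eq_mul, mul_one]
  push_cast
  rw [Nat.cast_choose ℝ hki, ← hsign]
  field_simp

theorem pow_eq_sum_laguerre (hα : -1 < α) (j : ℕ) (x : ℝ) :
    x ^ j = Gamma (j + α + 1) * ∑ i ∈ Finset.range (j + 1),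
      j.choose i * ((-1) ^ i * i.factorial / Gamma (i + α + 1) * laguerre α i x) := by
  have hnewton := shift_eq_sum_fwdDiff_iter 1 (fun k : ℕ => x ^ k / Gamma (k + α + 1)) j 0
  simp only [zero_add, smul_eq_mul, mul_one, nsmul_eq_mul, fwdDiff_iter_pow_div_Gamma hα]
    at hnewton
  rw [← hnewton, mul_div_cancel₀ _ (Gamma_natCast_add_pos hα j).ne']

theorem continuous_laguerre (α : ℝ) (j : ℕ) : Continuous (laguerre α j) := by
  unfold laguerre
  fun_prop

theorem laguerre_zero (hα : -1 < α) (x : ℝ) : laguerre α 0 x = 1 := by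
  simpa [laguerre] using div_self (Gamma_natCast_add_pos hα 0).ne'

theorem laguerre_apply_zero_pos (hα : -1 < α) (j : ℕ) : 0 < laguerre α j 0 := by
  rw [laguerre, Finset.sum_eq_single_of_mem 0 (by simp) fun i _ hi => by simp [hi]]
  have h₀ := Gamma_natCast_add_pos hα 0
  have hj := Gamma_natCast_add_pos hα j
  simp only [pow_zero, one_mul, Nat.sub_zero, Nat.factorial_zero, Nat.cast_one, div_one, mul_one]
  positivity

end Laguerre

/-- The measure `x ^ α dx` on `(0, ∞)`, for which the Hankel transform of order `α` is symmetric. -/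
def rpowMeasure (α : ℝ) : Measure ℝ :=
  (volume.restrict (Ioi 0)).withDensity fun x => .ofReal (x ^ α)

instance (α : ℝ) : SFinite (rpowMeasure α) := by
  unfold rpowMeasure
  infer_instance

section RpowMeasure

variable {α : ℝ} {φ : ℝ → ℝ}

theorem ae_rpowMeasure_pos (α : ℝ) : ∀ᵐ x ∂rpowMeasure α, 0 < x :=
  (withDensity_absolutelyContinuous _ _).ae_le (ae_restrict_mem measurableSet_Ioi)

theorem ae_rpowMeasure_nonneg (α : ℝ) : ∀ᵐ x ∂rpowMeasure α, 0 ≤ x :=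
  (ae_rpowMeasure_pos α).mono fun _ => le_of_lt

theorem integrable_rpowMeasure_iff :
    Integrable φ (rpowMeasure α) ↔ IntegrableOn (fun x => φ x * x ^ α) (Ioi 0) := by
  rw [rpowMeasure, integrable_withDensity_iff_integrable_smul₀' (by fun_prop)
    (ae_of_all _ fun _ => ENNReal.ofReal_lt_top)]
  refine integrableOn_congr_fun (fun x (hx : 0 < x) => ?_) measurableSet_Ioi
  rw [ENNReal.toReal_ofReal (by positivity), smul_eq_mul, mul_comm]

theorem integral_rpowMeasure (α : ℝ) (φ : ℝ → ℝ) :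
    ∫ x, φ x ∂rpowMeasure α = ∫ x in Ioi 0, φ x * x ^ α := by
  rw [rpowMeasure, integral_withDensity_eq_integral_toReal_smul₀ (by fun_prop)
    (ae_of_all _ fun _ => ENNReal.ofReal_lt_top)]
  refine setIntegral_congr_fun measurableSet_Ioi fun x (hx : 0 < x) => ?_
  simp only [ENNReal.toReal_ofReal (rpow_nonneg hx.le α), smul_eq_mul, mul_comm]

theorem rpowMeasure_pos_of_isOpen {U : Set ℝ} (hU : IsOpen U) (h : (U ∩ Ioi 0).Nonempty) :
    0 < rpowMeasure α U := by
  have hac : volume.restrict (Ioi 0) ≪ rpowMeasure α := by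
    refine withDensity_absolutelyContinuous' (by fun_prop) ?_
    filter_upwards [ae_restrict_mem measurableSet_Ioi] with x hx
    exact (ENNReal.ofReal_pos.2 (rpow_pos_of_pos hx α)).ne'
  refine pos_of_ne_zero fun h₀ => ((hU.inter isOpen_Ioi).measure_pos volume h).ne' ?_
  rw [← Measure.restrict_apply hU.measurableSet, hac h₀]

end RpowMeasure

/-- The Hankel transform of order `α` of the measure `φ dν`, in the variables in which the kernel is
`besselSeries α`. It is an involution for `ν = rpowMeasure α`. -/
def hankel (α : ℝ) (ν : Measure ℝ) (φ : ℝ → ℝ) (s : ℝ) : ℝ :=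
  ∫ x, besselSeries α (x * s) * φ x ∂ν

section Hankel

variable {α : ℝ} {μ ν : Measure ℝ} {φ ψ : ℝ → ℝ}

theorem norm_besselSeries_mul_le (hα : -1 / 2 ≤ α) {t : ℝ} (ht : 0 ≤ t) (r : ℝ) :
    ‖besselSeries α t * r‖ ≤ 1 / Gamma (α + 1) * ‖r‖ := by
  rw [norm_mul]
  exact mul_le_mul_of_nonneg_right (abs_besselSeries_le hα ht) (norm_nonneg r)

theorem integrable_besselSeries_mul (hα : -1 / 2 ≤ α) (hν : ∀ᵐ x ∂ν, 0 ≤ x) (hφ : Integrable φ ν)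
    {s : ℝ} (hs : 0 ≤ s) : Integrable (fun x => besselSeries α (x * s) * φ x) ν := by
  have hcont := continuous_besselSeries (show -1 < α by linarith)
  refine (hφ.norm.const_mul (1 / Gamma (α + 1))).mono'
    ((by fun_prop : Continuous fun x => besselSeries α (x * s)).aestronglyMeasurable.mul hφ.1) ?_
  filter_upwards [hν] with x hx using norm_besselSeries_mul_le hα (mul_nonneg hx hs) _

theorem abs_hankel_le (hα : -1 / 2 ≤ α) (hν : ∀ᵐ x ∂ν, 0 ≤ x) (hφ : Integrable φ ν) {s : ℝ}
    (hs : 0 ≤ s) : |hankel α ν φ s| ≤ 1 / Gamma (α + 1) * ∫ x, ‖φ x‖ ∂ν := by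
  rw [← integral_const_mul, ← norm_eq_abs]
  refine norm_integral_le_of_norm_le (hφ.norm.const_mul _) ?_
  filter_upwards [hν] with x hx using norm_besselSeries_mul_le hα (mul_nonneg hx hs) _

theorem continuousOn_hankel (hα : -1 / 2 ≤ α) (hν : ∀ᵐ x ∂ν, 0 ≤ x) (hφ : Integrable φ ν) :
    ContinuousOn (hankel α ν φ) (Ici 0) := by
  have hcont := continuous_besselSeries (show -1 < α by linarith)
  refine continuousOn_of_dominated (bound := fun x => 1 / Gamma (α + 1) * ‖φ x‖)
    (fun s hs => (integrable_besselSeries_mul hα hν hφ hs).1) (fun s hs => ?_)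
    (hφ.norm.const_mul _) (ae_of_all _ fun x => ?_)
  · filter_upwards [hν] with x hx using norm_besselSeries_mul_le hα (mul_nonneg hx hs) _
  · exact Continuous.continuousOn (by fun_prop)

theorem integral_mul_hankel_comm [SFinite μ] [SFinite ν] (hα : -1 / 2 ≤ α)
    (hμ : ∀ᵐ x ∂μ, 0 ≤ x) (hν : ∀ᵐ s ∂ν, 0 ≤ s) (hφ : Integrable φ μ) (hψ : Integrable ψ ν) :
    ∫ x, φ x * hankel α ν ψ x ∂μ = ∫ s, ψ s * hankel α μ φ s ∂ν := by
  have hcont := continuous_besselSeries (show -1 < α by linarith)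
  have hint : Integrable (fun z : ℝ × ℝ => besselSeries α (z.1 * z.2) * (φ z.1 * ψ z.2))
      (μ.prod ν) := by
    have hprod := hφ.mul_prod hψ
    refine (hprod.norm.const_mul (1 / Gamma (α + 1))).mono' ((by fun_prop :
      Continuous fun z : ℝ × ℝ => besselSeries α (z.1 * z.2)).aestronglyMeasurable.mul hprod.1) ?_
    filter_upwards [Measure.quasiMeasurePreserving_fst.ae hμ,
      Measure.quasiMeasurePreserving_snd.ae hν] with z hz₁ hz₂
    exact norm_besselSeries_mul_le hα (mul_nonneg hz₁ hz₂) _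
  calc ∫ x, φ x * hankel α ν ψ x ∂μ
      = ∫ x, ∫ s, besselSeries α (x * s) * (φ x * ψ s) ∂ν ∂μ := by
        refine integral_congr_ae (ae_of_all _ fun x => ?_)
        simp only [hankel, ← integral_const_mul, mul_comm x, mul_left_comm (φ x)]
    _ = ∫ s, ∫ x, besselSeries α (x * s) * (φ x * ψ s) ∂μ ∂ν := integral_integral_swap hint
    _ = ∫ s, ψ s * hankel α μ φ s ∂ν := by
        refine integral_congr_ae (ae_of_all _ fun s => ?_)
        simp only [hankel, ← integral_const_mul, ← mul_assoc, mul_comm _ (ψ s)]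

end Hankel

/-- The functions `s ^ j * exp (-r s)`, which are up to scalars the Hankel transforms of the
functions `laguerreFunction α j r`. -/
def gammaKernel (j : ℕ) (r s : ℝ) : ℝ :=
  s ^ j * exp (-(r * s))

/-- The functions `L_j^α(x / r) * exp (-x / r)` against which the Laguerre coefficients of dilations
are integrated. -/
def laguerreFunction (α : ℝ) (j : ℕ) (r x : ℝ) : ℝ :=
  laguerre α j (x / r) * exp (-(x / r))

section HankelPair

variable {α r : ℝ}

theorem gammaKernel_nonneg (j : ℕ) (r : ℝ) {s : ℝ} (hs : 0 ≤ s) : 0 ≤ gammaKernel j r s := by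
  unfold gammaKernel
  positivity

theorem continuous_gammaKernel (j : ℕ) (r : ℝ) : Continuous (gammaKernel j r) := by
  unfold gammaKernel
  fun_prop

theorem gammaKernel_mul_rpow {s : ℝ} (hs : 0 < s) (j : ℕ) :
    gammaKernel j r s * s ^ α = s ^ (j + α) * exp (-(r * s)) := by
  rw [gammaKernel, rpow_add hs, rpow_natCast]
  ring

theorem integrable_gammaKernel (hα : -1 < α) (hr : 0 < r) (j : ℕ) :
    Integrable (gammaKernel j r) (rpowMeasure α) := by
  have hj : -1 < j + α := by
    have := j.cast_nonneg (α := ℝ)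
    linarith
  refine integrable_rpowMeasure_iff.2 ((integrableOn_rpow_mul_exp_neg_mul_rpow hj one_pos
    hr).congr_fun (fun s hs => ?_) measurableSet_Ioi)
  simp only [rpow_one, gammaKernel_mul_rpow hs, neg_mul]

theorem integral_gammaKernel (hα : -1 < α) (hr : 0 < r) (j : ℕ) :
    ∫ s, gammaKernel j r s ∂rpowMeasure α = Gamma (j + α + 1) / r ^ (j + α + 1) := by
  have hj : 0 < j + α + 1 := by
    have := j.cast_nonneg (α := ℝ)
    linarith
  rw [integral_rpowMeasure, setIntegral_congr_fun measurableSet_Ioi fun s hs =>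
    gammaKernel_mul_rpow hs j, div_eq_inv_mul, ← inv_rpow hr.le, ← one_div,
    ← integral_rpow_mul_exp_neg_mul_Ioi hj hr, add_sub_cancel_right]

theorem integral_mul_gammaKernel_eq_gammaRatio (hα : -1 < α) (hr : 0 < r) (j m : ℕ) (c y : ℝ) :
    ∫ t, c / Gamma (m + α + 1) * (y ^ m / m.factorial) * gammaKernel (m + j) r t ∂rpowMeasure α =
      c * (gammaRatio α j 0 m * ((y / r) ^ m / m.factorial)) / r ^ (j + α + 1) := by
  rw [integral_const_mul, integral_gammaKernel hα hr, gammaRatio, add_zero,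
    show ((m + j : ℕ) : ℝ) + α + 1 = m + (j + α + 1) by push_cast; ring, rpow_add hr, rpow_natCast,
    div_pow]
  field_simp

theorem hankel_gammaKernel (hα : -1 < α) (hr : 0 < r) (j : ℕ) (x : ℝ) :
    hankel α (rpowMeasure α) (gammaKernel j r) x =
      j.factorial / r ^ (j + α + 1) * laguerreFunction α j r x := by
  set F : ℕ → ℝ → ℝ := fun m t =>
    besselCoeff α m * (x ^ m / m.factorial) * gammaKernel (m + j) r t with hF
  have hint (m : ℕ) : ∫ t, F m t ∂rpowMeasure α =
      gammaRatio α j 0 m * ((-(x / r)) ^ m / m.factorial) / r ^ (j + α + 1) := by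
    rw [hF, ← neg_one_mul, mul_pow]
    simp only [besselCoeff, integral_mul_gammaKernel_eq_gammaRatio hα hr]
    ring
  have hnorm (m : ℕ) : ∫ t, ‖F m t‖ ∂rpowMeasure α =
      gammaRatio α j 0 m * ((|x| / r) ^ m / m.factorial) / r ^ (j + α + 1) := by
    rw [← one_mul (gammaRatio _ _ _ _ * _), ← integral_mul_gammaKernel_eq_gammaRatio hα hr]
    refine integral_congr_ae ?_
    filter_upwards [ae_rpowMeasure_nonneg α] with t ht
    rw [hF, norm_mul, norm_mul, norm_of_nonneg (gammaKernel_nonneg _ r ht), norm_eq_abs,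
      abs_besselCoeff hα, one_div, norm_div, norm_pow, norm_natCast, norm_eq_abs]
  have hsum := hasSum_integral_of_summable_integral_norm (F := F)
    (fun m => (integrable_gammaKernel hα hr _).const_mul _)
    (by simpa only [hnorm] using ((hasSum_gammaRatio hα j (|x| / r)).div_const _).summable)
  have hseries (t : ℝ) : ∑' m, F m t = besselSeries α (t * x) * gammaKernel j r t := by
    rw [← ((hasSum_besselSeries hα (t * x)).mul_right (gammaKernel j r t)).tsum_eq]
    refine tsum_congr fun m => ?_
    simp only [hF, gammaKernel, mul_pow, pow_add]
    ring
  simp only [hint, hseries] at hsum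
  refine (hsum.unique ((hasSum_gammaRatio hα j (-(x / r))).div_const _)).trans ?_
  rw [neg_neg, laguerreFunction]
  ring

theorem laguerreFunction_zero (hα : -1 < α) (r : ℝ) :
    laguerreFunction α 0 r = gammaKernel 0 r⁻¹ := by
  funext x
  rw [laguerreFunction, laguerre_zero hα, gammaKernel, pow_zero, div_eq_inv_mul]

theorem laguerreFunction_eq_sum_gammaKernel (α : ℝ) (j : ℕ) (r x : ℝ) :
    laguerreFunction α j r x = ∑ k ∈ Finset.range (j + 1),
      (-1) ^ k * (Gamma (j + α + 1) / ((j - k).factorial * Gamma (k + α + 1))) *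
        (r⁻¹ ^ k / k.factorial) * gammaKernel k r⁻¹ x := by
  rw [laguerreFunction, laguerre, Finset.sum_mul]
  refine Finset.sum_congr rfl fun k _ => ?_
  rw [gammaKernel, div_eq_inv_mul x r, mul_pow]
  ring

theorem integrable_pow_mul_laguerreFunction (hα : -1 < α) (hr : 0 < r) (i j : ℕ) :
    Integrable (fun x => x ^ i * laguerreFunction α j r x) (rpowMeasure α) := by
  simp only [laguerreFunction_eq_sum_gammaKernel, Finset.mul_sum, mul_left_comm (_ ^ i)]
  refine integrable_finsetSum _ fun k _ => Integrable.const_mul ?_ _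
  refine (integrable_gammaKernel hα (inv_pos.2 hr) (i + k)).congr (ae_of_all _ fun x => ?_)
  simp only [gammaKernel, pow_add, mul_assoc]

theorem integrable_laguerreFunction (hα : -1 < α) (hr : 0 < r) (j : ℕ) :
    Integrable (laguerreFunction α j r) (rpowMeasure α) := by
  simpa only [pow_zero, one_mul] using integrable_pow_mul_laguerreFunction hα hr 0 j

theorem hankel_laguerreFunction (hα : -1 / 2 ≤ α) (hr : 0 < r) (j : ℕ) {s : ℝ} (hs : 0 ≤ s) :
    hankel α (rpowMeasure α) (laguerreFunction α j r) s =
      r ^ (j + α + 1) / j.factorial * gammaKernel j r s := by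
  have hα' : -1 < α := by linarith
  have hpow (k : ℕ) : r⁻¹ ^ (k + α + 1) = r⁻¹ ^ k / r ^ (α + 1) := by
    rw [add_assoc, rpow_add (inv_pos.2 hr), rpow_natCast, inv_rpow hr.le (α + 1), div_eq_mul_inv]
  calc hankel α (rpowMeasure α) (laguerreFunction α j r) s
      = ∑ k ∈ Finset.range (j + 1),
          (-1) ^ k * (Gamma (j + α + 1) / ((j - k).factorial * Gamma (k + α + 1))) *
            (r⁻¹ ^ k / k.factorial) * hankel α (rpowMeasure α) (gammaKernel k r⁻¹) s := by
        simp only [hankel, laguerreFunction_eq_sum_gammaKernel, Finset.mul_sum]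
        rw [integral_finsetSum _ fun k _ => integrable_besselSeries_mul hα (ae_rpowMeasure_nonneg α)
          ((integrable_gammaKernel hα' (inv_pos.2 hr) k).const_mul _) hs]
        simp only [mul_left_comm (besselSeries α _), integral_const_mul]
    _ = r ^ (α + 1) * exp (-(r * s)) / j.factorial *
          (Gamma (j + α + 1) * ∑ k ∈ Finset.range (j + 1), j.choose k *
            ((-1) ^ k * k.factorial / Gamma (k + α + 1) * laguerre α k (r * s))) := by
        rw [Finset.mul_sum, Finset.mul_sum]
        refine Finset.sum_congr rfl fun k hk => ?_
        rw [hankel_gammaKernel hα' (inv_pos.2 hr), hpow, laguerreFunction, div_inv_eq_mul,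
          mul_comm s r, Nat.cast_choose ℝ (Nat.lt_succ_iff.1 (Finset.mem_range.1 hk))]
        field_simp
    _ = r ^ (j + α + 1) / j.factorial * gammaKernel j r s := by
        rw [← pow_eq_sum_laguerre hα', gammaKernel, add_assoc (j : ℝ), rpow_add hr j,
          rpow_natCast, mul_pow]
        ring

end HankelPair

theorem mul_pow_succ_le_sub_indicator {X : Type*} {h p : X → ℝ} {V : Set X} {c q q' : ℝ} {u : X}
    (hc : 0 ≤ c) (hq : 0 ≤ q) (hq' : 0 ≤ q') (hV : u ∈ V → h u ≤ -c ∧ q' ≤ p u) (hp : 0 ≤ p u)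
    (hhp : h u ≤ 0 ∨ p u ≤ q) (j : ℕ) :
    h u * p u ^ (j + 1) ≤ q ^ j * ‖h u * p u‖ - V.indicator (fun _ => c * q' ^ (j + 1)) u := by
  by_cases huV : u ∈ V
  · obtain ⟨hhu, hpu⟩ := hV huV
    rw [indicator_of_mem huV]
    calc h u * p u ^ (j + 1) ≤ -c * p u ^ (j + 1) := by gcongr
      _ ≤ -(c * q' ^ (j + 1)) := by
        rw [neg_mul]
        gcongr
      _ ≤ _ := by
        rw [sub_eq_neg_add]
        exact le_add_of_nonneg_right (by positivity)
  · rw [indicator_of_notMem huV, sub_zero]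
    rcases hhp with hhu | hpu
    · exact (mul_nonpos_of_nonpos_of_nonneg hhu (by positivity)).trans (by positivity)
    · calc h u * p u ^ (j + 1) = p u ^ j * (h u * p u) := by ring
        _ ≤ p u ^ j * ‖h u * p u‖ := mul_le_mul_of_nonneg_left (le_norm_self _) (by positivity)
        _ ≤ q ^ j * ‖h u * p u‖ := by gcongr

theorem integrable_mul_pow_succ {X : Type*} [MeasurableSpace X] {μ : Measure X} {h p : X → ℝ}
    {B : ℝ} (hp₀ : ∀ᵐ u ∂μ, 0 ≤ p u) (hpB : ∀ᵐ u ∂μ, p u ≤ B) (hpm : AEStronglyMeasurable p μ)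
    (hint : Integrable (fun u => h u * p u) μ) (j : ℕ) :
    Integrable (fun u => h u * p u ^ (j + 1)) μ := by
  have hbdd : ∀ᵐ u ∂μ, ‖p u ^ j‖ ≤ B ^ j := by
    filter_upwards [hp₀, hpB] with u hu₀ huB
    rw [norm_pow, norm_of_nonneg hu₀]
    gcongr
  refine (hint.mul_bdd (hpm.pow j) hbdd).congr (ae_of_all _ fun u => ?_)
  simp only [Pi.pow_apply]
  ring

/-- If `V` were not null, then as `j → ∞` its negative contribution, of order `q' ^ j`, would
outweigh the positive one of `{p ≤ q}`, of order `q ^ j`. -/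
theorem measure_eq_zero_of_forall_integral_mul_pow_nonneg {X : Type*} [MeasurableSpace X]
    {μ : Measure X} {h p : X → ℝ} {V : Set X} {B c q q' : ℝ} (hVm : MeasurableSet V)
    (hc : 0 < c) (hq : 0 ≤ q) (hqq' : q < q') (hV : ∀ u ∈ V, h u ≤ -c ∧ q' ≤ p u)
    (hhp : ∀ᵐ u ∂μ, h u ≤ 0 ∨ p u ≤ q) (hp₀ : ∀ᵐ u ∂μ, 0 ≤ p u) (hpB : ∀ᵐ u ∂μ, p u ≤ B)
    (hpm : AEStronglyMeasurable p μ) (hint : Integrable (fun u => h u * p u) μ)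
    (hnonneg : ∀ j : ℕ, 0 ≤ ∫ u, h u * p u ^ (j + 1) ∂μ) : μ V = 0 := by
  have hq' : 0 < q' := hq.trans_lt hqq'
  have hVfin : μ V ≠ ⊤ := by
    refine ((measure_mono fun u hu => ?_).trans_lt
      (hint.measure_norm_ge_lt_top (mul_pos hc hq'))).ne
    obtain ⟨hhu, hpu⟩ := hV u hu
    rw [mem_ofPred_eq, norm_mul]
    gcongr
    exacts [le_abs.2 (.inr (by linarith)), hpu.trans (le_abs_self _)]
  have hbound (j : ℕ) : c * q' ^ (j + 1) * μ.real V ≤ q ^ j * ∫ u, ‖h u * p u‖ ∂μ := by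
    have hind : Integrable (V.indicator fun _ => c * q' ^ (j + 1)) μ :=
      (integrable_indicator_iff hVm).2 (integrableOn_const hVfin)
    have hle := (hnonneg j).trans (integral_mono_ae (integrable_mul_pow_succ hp₀ hpB hpm hint j)
      ((hint.norm.const_mul (q ^ j)).sub hind) (by
        filter_upwards [hhp, hp₀] with u hu hu₀ using
          mul_pow_succ_le_sub_indicator hc.le hq hq'.le (hV u) hu₀ hu j))
    simp only [Pi.sub_apply] at hle
    rw [integral_sub (hint.norm.const_mul _) hind, integral_const_mul,
      integral_indicator_const _ hVm, smul_eq_mul, mul_comm (μ.real V)] at hle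
    exact sub_nonneg.1 hle
  have hlim : Tendsto (fun j : ℕ => (q / q') ^ j * ∫ u, ‖h u * p u‖ ∂μ) atTop (𝓝 0) := by
    simpa using (tendsto_pow_atTop_nhds_zero_of_lt_one (by positivity)
      ((div_lt_one hq').2 hqq')).mul_const (∫ u, ‖h u * p u‖ ∂μ)
  have hle : c * q' * μ.real V ≤ 0 := by
    refine ge_of_tendsto' hlim fun j => ?_
    rw [div_pow, div_mul_eq_mul_div, le_div_iff₀ (by positivity)]
    exact (hbound j).trans_eq' (by ring)
  by_contra hV₀
  have hVpos : 0 < μ.real V := ENNReal.toReal_pos hV₀ hVfin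
  exact hle.not_gt (by positivity)

/-- Laplace's method: the weights `p ^ j` concentrate at the strict maximum `x` of `p`. -/
theorem nonneg_of_forall_integral_mul_pow_nonneg {X : Type*} [TopologicalSpace X]
    [MeasurableSpace X] [OpensMeasurableSpace X] {μ : Measure X} {h p : X → ℝ} {x : X}
    (hh : ContinuousAt h x) (hp : ContinuousAt p x) (hpx : 0 < p x)
    (hp₀ : ∀ᵐ u ∂μ, 0 ≤ p u) (hpm : AEStronglyMeasurable p μ)
    (hgap : ∀ U ∈ 𝓝 x, ∃ q < p x, ∀ᵐ u ∂μ, u ∉ U → p u ≤ q) (hμ : ∀ U ∈ 𝓝 x, 0 < μ U)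
    (hint : Integrable (fun u => h u * p u) μ)
    (hnonneg : ∀ j : ℕ, 0 ≤ ∫ u, h u * p u ^ (j + 1) ∂μ) : 0 ≤ h x := by
  by_contra! hneg
  obtain ⟨q₀, hq₀, hpq₀⟩ := hgap _
    ((hh.eventually_lt_const hneg).and (hp.eventually_lt_const (lt_add_one (p x))))
  obtain ⟨q', hq', hq'x⟩ := exists_between (max_lt hq₀ hpx)
  obtain ⟨V, hV, hVo, hxV⟩ := mem_nhds_iff.1
    ((hh.eventually_lt_const (show h x < -(-h x / 2) by linarith)).and
      (hp.eventually_const_lt hq'x))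
  refine (hμ V (hVo.mem_nhds hxV)).ne' (measure_eq_zero_of_forall_integral_mul_pow_nonneg
    (B := p x + 1) hVo.measurableSet (by linarith) (le_max_right q₀ 0) hq'
    (fun u hu => ⟨(hV hu).1.le, (hV hu).2.le⟩) ?_ hp₀ ?_ hpm hint hnonneg)
  all_goals filter_upwards [hpq₀] with u hu
  · by_cases huU : u ∈ {u | h u < 0 ∧ p u < p x + 1}
    exacts [.inl huU.1.le, .inr ((hu huU).trans (le_max_left _ _))]
  · by_cases huU : u ∈ {u | h u < 0 ∧ p u < p x + 1}
    exacts [huU.2.le, (hu huU).trans (by linarith)]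

theorem exists_lt_one_forall_mul_exp_one_sub_le {η : ℝ} (hη : 0 < η) :
    ∃ q < 1, ∀ w, 0 ≤ w → η ≤ |w - 1| → w * exp (1 - w) ≤ q := by
  set k := η ^ 2 / (4 * (1 + η)) with hk
  have hk₀ : 0 < k := by positivity
  refine ⟨(1 + k)⁻¹, inv_lt_one_of_one_lt₀ (by linarith), fun w hw hηw => ?_⟩
  have hexp : w + (w - 1) ^ 2 / 4 ≤ exp (w - 1) := by
    calc w + (w - 1) ^ 2 / 4 = ((w - 1) / 2 + 1) ^ 2 := by ring
      _ ≤ exp ((w - 1) / 2) ^ 2 := by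
        gcongr
        exacts [by linarith, add_one_le_exp _]
      _ = exp (w - 1) := by rw [← exp_nat_mul]; ring_nf
  have hkw : k * w ≤ (w - 1) ^ 2 / 4 := by
    have hw' : w ≤ 1 + |w - 1| := by linarith [le_abs_self (w - 1)]
    rw [hk, ← sq_abs (w - 1), div_mul_eq_mul_div, div_le_div_iff₀ (by positivity) (by norm_num)]
    nlinarith [mul_le_mul_of_nonneg_left hw' (sq_nonneg η), mul_nonneg hη.le (abs_nonneg (w - 1)),
      mul_nonneg (mul_nonneg hη.le (abs_nonneg (w - 1))) (sub_nonneg.2 hηw)]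
  rw [← neg_sub w 1, exp_neg, ← div_eq_mul_inv, div_le_iff₀ (exp_pos _), inv_mul_eq_div,
    le_div_iff₀ (by linarith)]
  linarith

section GammaKernel

variable {α : ℝ}

theorem gammaKernel_one_pow (j : ℕ) (r s : ℝ) :
    gammaKernel 1 r s ^ j = gammaKernel j (j * r) s := by
  rw [gammaKernel, gammaKernel, pow_one, mul_pow, ← exp_nat_mul]
  ring_nf

theorem exists_lt_forall_gammaKernel_le {x : ℝ} (hx : 0 < x) {U : Set ℝ} (hU : U ∈ 𝓝 x) :
    ∃ q < gammaKernel 1 x⁻¹ x, ∀ u, 0 ≤ u → u ∉ U → gammaKernel 1 x⁻¹ u ≤ q := by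
  obtain ⟨δ, hδ, hball⟩ := Metric.mem_nhds_iff.1 hU
  obtain ⟨q, hq, hle⟩ := exists_lt_one_forall_mul_exp_one_sub_le (div_pos hδ hx)
  have hscale (u : ℝ) : gammaKernel 1 x⁻¹ u = x * exp (-1) * (u / x * exp (1 - u / x)) := by
    rw [gammaKernel, pow_one, mul_mul_mul_comm, ← exp_add, mul_div_cancel₀ u hx.ne']
    ring_nf
  refine ⟨x * exp (-1) * q, ?_, fun u hu huU => ?_⟩
  · rw [hscale, div_self hx.ne', sub_self, exp_zero, one_mul]
    gcongr
  · rw [hscale]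
    gcongr
    refine hle _ (by positivity) ?_
    rw [div_sub_one hx.ne', abs_div, abs_of_pos hx]
    gcongr
    exact not_lt.1 fun hlt => huU (hball hlt)

theorem nonneg_of_forall_integral_mul_gammaKernel_nonneg {h : ℝ → ℝ}
    (hh : ContinuousOn h (Ioi 0))
    (hint : ∀ r, 0 < r → Integrable (fun u => h u * gammaKernel 1 r u) (rpowMeasure α))
    (hnonneg : ∀ j r, 0 < r → 0 ≤ ∫ u, h u * gammaKernel j r u ∂rpowMeasure α) {x : ℝ}
    (hx : 0 < x) : 0 ≤ h x := by
  have hcont := continuous_gammaKernel 1 x⁻¹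
  refine nonneg_of_forall_integral_mul_pow_nonneg (hh.continuousAt (Ioi_mem_nhds hx))
    hcont.continuousAt (by unfold gammaKernel; positivity)
    ((ae_rpowMeasure_nonneg α).mono fun _ => gammaKernel_nonneg 1 x⁻¹)
    hcont.aestronglyMeasurable (fun U hU => ?_) (fun U hU => ?_) (hint _ (inv_pos.2 hx))
    fun j => ?_
  · obtain ⟨q, hq, hle⟩ := exists_lt_forall_gammaKernel_le hx hU
    exact ⟨q, hq, (ae_rpowMeasure_nonneg α).mono hle⟩
  · exact (rpowMeasure_pos_of_isOpen isOpen_interior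
      ⟨x, mem_interior_iff_mem_nhds.2 hU, hx⟩).trans_le (measure_mono interior_subset)
  · simp only [gammaKernel_one_pow]
    exact hnonneg _ _ (by positivity)

theorem eq_zero_of_forall_integral_mul_gammaKernel_eq_zero {h : ℝ → ℝ}
    (hh : ContinuousOn h (Ioi 0))
    (hint : ∀ r, 0 < r → Integrable (fun u => h u * gammaKernel 1 r u) (rpowMeasure α))
    (hzero : ∀ j r, 0 < r → ∫ u, h u * gammaKernel j r u ∂rpowMeasure α = 0) {x : ℝ}
    (hx : 0 < x) : h x = 0 := by
  refine (neg_nonneg.1 (nonneg_of_forall_integral_mul_gammaKernel_nonneg (α := α) hh.neg ?_ ?_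
    hx)).antisymm
    (nonneg_of_forall_integral_mul_gammaKernel_nonneg hh hint (fun j r hr => (hzero j r hr).ge) hx)
  · simp only [Pi.neg_apply, neg_mul]
    exact fun r hr => (hint r hr).neg
  · simp only [Pi.neg_apply, neg_mul, integral_neg]
    exact fun j r hr => (neg_eq_zero.2 (hzero j r hr)).ge

end GammaKernel

section LaguerreCoefficients

variable {α : ℝ}

theorem integrable_laguerre_sq_mul_exp (hα : -1 < α) (j : ℕ) :
    Integrable (fun x => laguerre α j x ^ 2 * exp (-x)) (rpowMeasure α) := by
  have hsum (x : ℝ) : laguerre α j x ^ 2 * exp (-x) = ∑ i ∈ Finset.range (j + 1),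
      (-1) ^ i * (Gamma (j + α + 1) / ((j - i).factorial * Gamma (i + α + 1))) / i.factorial *
        (x ^ i * laguerreFunction α j 1 x) := by
    rw [sq, mul_assoc]
    nth_rewrite 1 [laguerre]
    rw [Finset.sum_mul]
    refine Finset.sum_congr rfl fun i _ => ?_
    rw [laguerreFunction, div_one]
    ring
  simp only [hsum]
  exact integrable_finsetSum _ fun i _ =>
    (integrable_pow_mul_laguerreFunction hα one_pos i j).const_mul _

theorem integral_laguerre_sq_pos (hα : -1 < α) (j : ℕ) :
    0 < ∫ x in Ioi (0 : ℝ), laguerre α j x ^ 2 * x ^ α * exp (-x) := by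
  simp only [mul_right_comm _ _ (exp _)]
  rw [← integral_rpowMeasure α fun x => laguerre α j x ^ 2 * exp (-x),
    integral_pos_iff_support_of_nonneg (fun x => by positivity)
      (integrable_laguerre_sq_mul_exp hα j)]
  have hcont := continuous_laguerre α j
  refine rpowMeasure_pos_of_isOpen (isOpen_ne_fun (by fun_prop) continuous_const) ?_
  have hzero : (0 : ℝ) ∈ closure (Ioi 0) := by simp
  refine mem_closure_iff.1 hzero _ (isOpen_ne_fun (by fun_prop) continuous_const) ?_
  exact (mul_pos (pow_pos (laguerre_apply_zero_pos hα j) 2) (exp_pos _)).ne'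

theorem setIntegral_comp_div_mul_laguerre (f : ℝ → ℝ) (j : ℕ) {y : ℝ} (hy : 0 < y) :
    ∫ x in Ioi 0, f (x / y) * laguerre α j x * x ^ α * exp (-x) =
      y ^ (α + 1) * ∫ x, f x * laguerreFunction α j y⁻¹ x ∂rpowMeasure α := by
  have hscale := integral_comp_mul_left_Ioi
    (fun x => f (x / y) * laguerre α j x * x ^ α * exp (-x)) 0 hy
  rw [mul_zero, smul_eq_mul, eq_inv_mul_iff_mul_eq₀ hy.ne'] at hscale
  rw [← hscale, integral_rpowMeasure, rpow_add_one hy.ne', mul_comm (y ^ α), mul_assoc,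
    ← integral_const_mul (y ^ α)]
  congr 1
  refine setIntegral_congr_fun measurableSet_Ioi fun x (hx : 0 < x) => ?_
  simp only [laguerreFunction, div_inv_eq_mul, mul_comm x y]
  rw [mul_div_cancel_left₀ x hy.ne', mul_rpow hy.le hx.le]
  ring

theorem laguerreCoeff_comp_div_nonneg_iff (hα : -1 < α) (f : ℝ → ℝ) (j : ℕ) {y : ℝ} (hy : 0 < y) :
    0 ≤ laguerreCoeff α (fun x => f (x / y)) j ↔
      0 ≤ ∫ x, f x * laguerreFunction α j y⁻¹ x ∂rpowMeasure α := by
  rw [laguerreCoeff, le_div_iff₀ (integral_laguerre_sq_pos hα j), zero_mul,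
    setIntegral_comp_div_mul_laguerre f j hy, mul_nonneg_iff_of_pos_left (rpow_pos_of_pos hy _)]

theorem forall_laguerreCoeff_comp_div_nonneg_iff (hα : -1 < α) (f : ℝ → ℝ) :
    (∀ y, 0 < y → ∀ j, 0 ≤ laguerreCoeff α (fun x => f (x / y)) j) ↔
      ∀ j r, 0 < r → 0 ≤ ∫ x, f x * laguerreFunction α j r x ∂rpowMeasure α := by
  refine ⟨fun h j r hr => ?_, fun h y hy j =>
    (laguerreCoeff_comp_div_nonneg_iff hα f j hy).2 (h j _ (inv_pos.2 hy))⟩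
  simpa only [inv_inv] using (laguerreCoeff_comp_div_nonneg_iff hα f j (inv_pos.2 hr)).1
    (h _ (inv_pos.2 hr) j)

end LaguerreCoefficients

section Positivity

variable {α : ℝ} {f : ℝ → ℝ}

theorem integrable_hankel_mul {φ : ℝ → ℝ} (hα : -1 / 2 ≤ α) (hf : Integrable f (rpowMeasure α))
    (hφ : Integrable φ (rpowMeasure α)) :
    Integrable (fun s => hankel α (rpowMeasure α) f s * φ s) (rpowMeasure α) := by
  have hmeas : AEStronglyMeasurable (hankel α (rpowMeasure α) f) (rpowMeasure α) := by
    have hcont := (continuousOn_hankel hα (ae_rpowMeasure_nonneg α) hf).mono Ioi_subset_Ici_self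
    exact (hcont.aestronglyMeasurable measurableSet_Ioi).mono_ac
      (withDensity_absolutelyContinuous _ _)
  refine hφ.bdd_mul (c := 1 / Gamma (α + 1) * ∫ x, ‖f x‖ ∂rpowMeasure α) hmeas ?_
  filter_upwards [ae_rpowMeasure_nonneg α] with s hs
    using abs_hankel_le hα (ae_rpowMeasure_nonneg α) hf hs

theorem integral_hankel_mul_gammaKernel (hα : -1 / 2 ≤ α) (hf : Integrable f (rpowMeasure α))
    {r : ℝ} (hr : 0 < r) (j : ℕ) :
    ∫ s, hankel α (rpowMeasure α) f s * gammaKernel j r s ∂rpowMeasure α =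
      j.factorial / r ^ (j + α + 1) * ∫ x, f x * laguerreFunction α j r x ∂rpowMeasure α := by
  have hα' : -1 < α := by linarith
  simp only [mul_comm (hankel α _ f _)]
  rw [integral_mul_hankel_comm hα (ae_rpowMeasure_nonneg α) (ae_rpowMeasure_nonneg α)
    (integrable_gammaKernel hα' hr j) hf, ← integral_const_mul]
  simp only [hankel_gammaKernel hα' hr, mul_left_comm (f _)]

theorem integral_hankel_mul_laguerreFunction (hα : -1 / 2 ≤ α)
    (hf : Integrable f (rpowMeasure α)) {r : ℝ} (hr : 0 < r) (j : ℕ) :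
    ∫ s, hankel α (rpowMeasure α) f s * laguerreFunction α j r s ∂rpowMeasure α =
      r ^ (j + α + 1) / j.factorial * ∫ x, f x * gammaKernel j r x ∂rpowMeasure α := by
  have hα' : -1 < α := by linarith
  simp only [mul_comm (hankel α _ f _)]
  rw [integral_mul_hankel_comm hα (ae_rpowMeasure_nonneg α) (ae_rpowMeasure_nonneg α)
    (integrable_laguerreFunction hα' hr j) hf, ← integral_const_mul]
  refine integral_congr_ae ?_
  filter_upwards [ae_rpowMeasure_nonneg α] with s hs
  rw [hankel_laguerreFunction hα hr j hs, mul_left_comm]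

theorem hankel_nonneg_of_pos (hα : -1 / 2 ≤ α) (hf : Integrable f (rpowMeasure α))
    (hpos : ∀ j r, 0 < r → 0 ≤ ∫ x, f x * laguerreFunction α j r x ∂rpowMeasure α) {s : ℝ}
    (hs : 0 < s) : 0 ≤ hankel α (rpowMeasure α) f s := by
  refine nonneg_of_forall_integral_mul_gammaKernel_nonneg (α := α)
    ((continuousOn_hankel hα (ae_rpowMeasure_nonneg α) hf).mono Ioi_subset_Ici_self)
    (fun r hr => integrable_hankel_mul hα hf (integrable_gammaKernel (by linarith) hr 1))
    (fun j r hr => ?_) hs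
  rw [integral_hankel_mul_gammaKernel hα hf hr]
  exact mul_nonneg (by positivity) (hpos j r hr)

theorem gammaKernel_le {r s : ℝ} (hr : 0 < r) (hs : 0 ≤ s) (j : ℕ) :
    gammaKernel j r s ≤ j.factorial / r ^ j := by
  have hexp := pow_div_factorial_le_exp (r * s) (mul_nonneg hr.le hs) j
  rw [mul_pow, div_le_iff₀ (by positivity)] at hexp
  rw [gammaKernel, exp_neg, ← div_eq_mul_inv, div_le_div_iff₀ (exp_pos _) (by positivity)]
  linarith

theorem integrable_mul_gammaKernel (hf : Integrable f (rpowMeasure α)) {r : ℝ} (hr : 0 < r)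
    (j : ℕ) : Integrable (fun x => f x * gammaKernel j r x) (rpowMeasure α) := by
  refine hf.mul_bdd (continuous_gammaKernel j r).aestronglyMeasurable
    (c := j.factorial / r ^ j) ?_
  filter_upwards [ae_rpowMeasure_nonneg α] with x hx
  rw [norm_of_nonneg (gammaKernel_nonneg j r hx)]
  exact gammaKernel_le hr hx j

theorem exists_rpow_mul_exp_neg_le (a : ℝ) : ∃ K, ∀ u, 1 ≤ u → u ^ a * exp (-u) ≤ K := by
  refine ⟨⌈a⌉₊.factorial, fun u hu => ?_⟩
  have hexp := pow_div_factorial_le_exp u (zero_le_one.trans hu) ⌈a⌉₊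
  rw [div_le_iff₀ (by positivity)] at hexp
  rw [exp_neg, ← div_eq_mul_inv, div_le_iff₀ (exp_pos _), mul_comm]
  refine le_trans ?_ hexp
  rw [← rpow_natCast]
  exact rpow_le_rpow_of_exponent_le hu (Nat.le_ceil a)

theorem rpow_mul_mul_gammaKernel_zero_le {M K a u x : ℝ} (hM : ∀ x ∈ Icc 0 1, ‖f x‖ ≤ M)
    (hu : 0 < u) (hK : u ^ a * exp (-u) ≤ K) (hx : 0 ≤ x) :
    u ^ a * (f x * gammaKernel 0 u x) ≤ M * u ^ a * gammaKernel 0 u x + K * ‖f x‖ := by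
  have hM₀ := (norm_nonneg _).trans (hM 0 (left_mem_Icc.2 zero_le_one))
  have hK₀ := hK.trans' (by positivity)
  have hγ := mul_nonneg (rpow_nonneg hu.le a) (gammaKernel_nonneg 0 u hx)
  calc u ^ a * (f x * gammaKernel 0 u x)
      = f x * (u ^ a * gammaKernel 0 u x) := mul_left_comm _ _ _
    _ ≤ ‖f x‖ * (u ^ a * gammaKernel 0 u x) :=
      mul_le_mul_of_nonneg_right (le_norm_self (f x)) hγ
    _ ≤ M * (u ^ a * gammaKernel 0 u x) + ‖f x‖ * K := by
      rcases le_total x 1 with hx₁ | hx₁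
      · exact le_add_of_le_of_nonneg (mul_le_mul_of_nonneg_right (hM x ⟨hx, hx₁⟩) hγ)
          (by positivity)
      · refine le_add_of_nonneg_of_le (mul_nonneg hM₀ hγ)
          (mul_le_mul_of_nonneg_left (hK.trans' ?_) (norm_nonneg _))
        rw [gammaKernel, pow_zero, one_mul]
        gcongr
        exact le_mul_of_one_le_right hu.le hx₁
    _ = M * u ^ a * gammaKernel 0 u x + K * ‖f x‖ := by ring

theorem exists_rpow_mul_integral_mul_gammaKernel_zero_le (hα : -1 < α)
    (hfc : ContinuousOn f (Icc 0 1)) (hf : Integrable f (rpowMeasure α)) :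
    ∃ B, ∀ u, 1 ≤ u → u ^ (α + 1) * ∫ x, f x * gammaKernel 0 u x ∂rpowMeasure α ≤ B := by
  obtain ⟨M, hM⟩ := isCompact_Icc.exists_bound_of_continuousOn hfc
  obtain ⟨K, hK⟩ := exists_rpow_mul_exp_neg_le (α + 1)
  refine ⟨M * Gamma (α + 1) + K * ∫ x, ‖f x‖ ∂rpowMeasure α, fun u hu => ?_⟩
  have hu₀ : 0 < u := one_pos.trans_le hu
  have hγ := (integrable_gammaKernel hα hu₀ 0).const_mul (M * u ^ (α + 1))
  calc u ^ (α + 1) * ∫ x, f x * gammaKernel 0 u x ∂rpowMeasure α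
      ≤ ∫ x, M * u ^ (α + 1) * gammaKernel 0 u x + K * ‖f x‖ ∂rpowMeasure α := by
        rw [← integral_const_mul]
        exact integral_mono_ae ((integrable_mul_gammaKernel hf hu₀ 0).const_mul _)
          (hγ.add (hf.norm.const_mul K)) ((ae_rpowMeasure_nonneg α).mono
          fun x hx => rpow_mul_mul_gammaKernel_zero_le hM hu₀ (hK u hu) hx)
    _ = M * Gamma (α + 1) + K * ∫ x, ‖f x‖ ∂rpowMeasure α := by
        rw [integral_add hγ (hf.norm.const_mul K), integral_const_mul, integral_const_mul,
          integral_gammaKernel hα hu₀, Nat.cast_zero, zero_add, mul_assoc,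
          mul_div_cancel₀ _ (rpow_pos_of_pos hu₀ _).ne']

theorem integrable_of_tendsto_of_integral_le {μ : Measure ℝ} {G : ℕ → ℝ → ℝ} {h : ℝ → ℝ} {B : ℝ}
    (hlim : ∀ᵐ x ∂μ, Tendsto (fun n => G n x) atTop (𝓝 (h x))) (hG : ∀ n, Integrable (G n) μ)
    (hG₀ : ∀ n, 0 ≤ᵐ[μ] G n) (hB : ∀ n, ∫ x, G n x ∂μ ≤ B) : Integrable h μ := by
  refine integrable_of_tendsto hlim (fun n => (hG n).1)
    (ne_top_of_le_ne_top (b := ENNReal.ofReal B) ENNReal.ofReal_ne_top ?_)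
  refine (liminf_le_liminf (Eventually.of_forall fun n => ?_)).trans_eq (liminf_const _)
  rw [← ofReal_integral_norm_eq_lintegral_enorm (hG n)]
  refine ENNReal.ofReal_le_ofReal ((integral_congr_ae ?_).trans_le (hB n))
  filter_upwards [hG₀ n] with x hx using norm_of_nonneg hx

theorem integrable_hankel (hα : -1 / 2 ≤ α) (hfc : ContinuousOn f (Icc 0 1))
    (hf : Integrable f (rpowMeasure α)) (hnonneg : ∀ s, 0 < s → 0 ≤ hankel α (rpowMeasure α) f s) :
    Integrable (hankel α (rpowMeasure α) f) (rpowMeasure α) := by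
  have hα' : -1 < α := by linarith
  obtain ⟨B, hB⟩ := exists_rpow_mul_integral_mul_gammaKernel_zero_le hα' hfc hf
  have hr (n : ℕ) : 0 < 1 / ((n : ℝ) + 1) := Nat.one_div_pos_of_nat
  refine integrable_of_tendsto_of_integral_le (B := B)
    (G := fun n s => hankel α (rpowMeasure α) f s * gammaKernel 0 (1 / (n + 1)) s)
    (ae_of_all _ fun s => ?_)
    (fun n => integrable_hankel_mul hα hf (integrable_gammaKernel hα' (hr n) 0)) (fun n => ?_)
    fun n => ?_
  · have hexp : Continuous fun r : ℝ => gammaKernel 0 r s := by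
      unfold gammaKernel
      fun_prop
    have hone : gammaKernel 0 0 s = 1 := by simp [gammaKernel]
    simpa only [Function.comp_def, hone, mul_one] using
      ((hexp.tendsto 0).comp tendsto_one_div_add_atTop_nhds_zero_nat).const_mul _
  · filter_upwards [ae_rpowMeasure_pos α] with s hs
    exact mul_nonneg (hnonneg s hs) (gammaKernel_nonneg 0 _ hs.le)
  · rw [integral_hankel_mul_gammaKernel hα hf (hr n)]
    have hn := hB (n + 1) (by linarith [n.cast_nonneg (α := ℝ)])
    rwa [laguerreFunction_zero hα', one_div, inv_inv, Nat.cast_zero, zero_add,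
      inv_rpow (by positivity), Nat.factorial_zero, Nat.cast_one, one_div, inv_inv]

theorem hankel_hankel (hα : -1 / 2 ≤ α) (hfc : ContinuousOn f (Ici 0))
    (hf : Integrable f (rpowMeasure α))
    (hHf : Integrable (hankel α (rpowMeasure α) f) (rpowMeasure α)) :
    EqOn (hankel α (rpowMeasure α) (hankel α (rpowMeasure α) f)) f (Ici 0) := by
  set μ := rpowMeasure α
  have hμ := ae_rpowMeasure_nonneg α
  have hα' : -1 < α := by linarith
  have hHHfc := continuousOn_hankel hα hμ hHf
  have hfγ (j : ℕ) (r : ℝ) (hr : 0 < r) := integrable_mul_gammaKernel hf hr j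
  have hHHfγ (j : ℕ) (r : ℝ) (hr : 0 < r) :=
    integrable_hankel_mul hα hHf (integrable_gammaKernel hα' hr j)
  have hpos : EqOn (hankel α μ (hankel α μ f)) f (Ioi 0) := fun x hx => by
    refine sub_eq_zero.1 (eq_zero_of_forall_integral_mul_gammaKernel_eq_zero (α := α)
      ((hHHfc.sub hfc).mono Ioi_subset_Ici_self) (fun r hr => ?_) (fun j r hr => ?_) hx)
    · simp only [Pi.sub_apply, sub_mul]
      exact (hHHfγ 1 r hr).sub (hfγ 1 r hr)
    · simp only [Pi.sub_apply, sub_mul]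
      rw [integral_sub (hHHfγ j r hr) (hfγ j r hr), integral_hankel_mul_gammaKernel hα hHf hr,
        integral_hankel_mul_laguerreFunction hα hf hr, ← mul_assoc,
        div_mul_div_cancel₀ (rpow_pos_of_pos hr _).ne', div_self (by positivity), one_mul, sub_self]
  exact hpos.of_subset_closure hHHfc hfc Ioi_subset_Ici_self (closure_Ioi (0 : ℝ)).ge

end Positivity

section Representation

variable {α : ℝ} {f : ℝ → ℝ}

theorem integral_mul_laguerreFunction_nonneg (hα : -1 / 2 ≤ α) {ν : Measure ℝ} [IsFiniteMeasure ν]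
    (hν : ∀ᵐ s ∂ν, 0 ≤ s) (hfν : EqOn f (hankel α ν 1) (Ici 0)) {r : ℝ} (hr : 0 < r) (j : ℕ) :
    0 ≤ ∫ x, f x * laguerreFunction α j r x ∂rpowMeasure α := by
  have hμ := ae_rpowMeasure_nonneg α
  calc 0 ≤ ∫ s, 1 * hankel α (rpowMeasure α) (laguerreFunction α j r) s ∂ν := by
        refine integral_nonneg_of_ae ?_
        filter_upwards [hν] with s hs
        rw [one_mul, hankel_laguerreFunction hα hr j hs]
        exact mul_nonneg (by positivity) (gammaKernel_nonneg j r hs)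
    _ = ∫ x, laguerreFunction α j r x * hankel α ν 1 x ∂rpowMeasure α :=
        (integral_mul_hankel_comm hα hμ hν (integrable_laguerreFunction (by linarith) hr j)
          (integrable_const 1)).symm
    _ = ∫ x, f x * laguerreFunction α j r x ∂rpowMeasure α := by
        refine integral_congr_ae ?_
        filter_upwards [hμ] with x hx
        rw [hfν hx, mul_comm]

theorem exists_measure_eqOn_hankel (hα : -1 / 2 ≤ α) (hfc : ContinuousOn f (Ici 0))
    (hf : Integrable f (rpowMeasure α))
    (hpos : ∀ j r, 0 < r → 0 ≤ ∫ x, f x * laguerreFunction α j r x ∂rpowMeasure α) :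
    ∃ ν : Measure ℝ, IsFiniteMeasure ν ∧ (∀ᵐ s ∂ν, 0 ≤ s) ∧ EqOn f (hankel α ν 1) (Ici 0) := by
  have hnonneg : ∀ s, 0 < s → 0 ≤ hankel α (rpowMeasure α) f s := fun s hs =>
    hankel_nonneg_of_pos hα hf hpos hs
  have hint := integrable_hankel hα (hfc.mono Icc_subset_Ici_self) hf hnonneg
  refine ⟨(rpowMeasure α).withDensity fun s => .ofReal (hankel α (rpowMeasure α) f s),
    isFiniteMeasure_withDensity_ofReal hint.2,
    (withDensity_absolutelyContinuous _ _).ae_le (ae_rpowMeasure_nonneg α), fun x hx => ?_⟩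
  rw [← hankel_hankel hα hfc hf hint hx, hankel, hankel,
    integral_withDensity_eq_integral_toReal_smul₀ hint.1.aemeasurable.ennreal_ofReal
      (ae_of_all _ fun _ => ENNReal.ofReal_lt_top)]
  refine integral_congr_ae ?_
  filter_upwards [ae_rpowMeasure_pos α] with s hs
  rw [ENNReal.toReal_ofReal (hnonneg s hs), Pi.one_apply, mul_one, smul_eq_mul, mul_comm]

theorem forall_laguerreCoeff_nonneg_iff_exists_measure (hα : -1 / 2 ≤ α)
    (hfc : ContinuousOn f (Ici 0)) (hf : Integrable f (rpowMeasure α)) :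
    (∀ y, 0 < y → ∀ j, 0 ≤ laguerreCoeff α (fun x => f (x / y)) j) ↔
      ∃ ν : Measure ℝ, IsFiniteMeasure ν ∧ (∀ᵐ s ∂ν, 0 ≤ s) ∧ EqOn f (hankel α ν 1) (Ici 0) := by
  rw [forall_laguerreCoeff_comp_div_nonneg_iff (by linarith)]
  refine ⟨exists_measure_eqOn_hankel hα hfc hf, ?_⟩
  rintro ⟨ν, _, hν, hfν⟩ j r hr
  exact integral_mul_laguerreFunction_nonneg hα hν hfν hr j

end Representation

section Stieltjes

theorem tendsto_measureReal_Iio_nhdsGT (ν : Measure ℝ) [IsFiniteMeasure ν] (a : ℝ) :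
    Tendsto (fun b => ν.real (Iio b)) (𝓝[>] a) (𝓝 (ν.real (Iic a))) := by
  have hInter : ⋂ b > a, Iio b = Iic a := by
    ext x
    simp only [mem_iInter, mem_Iio, mem_Iic]
    exact ⟨le_of_forall_gt, fun hx b hb => hx.trans_lt hb⟩
  have htendsto := tendsto_measure_biInter_gt (μ := ν) (s := Iio) (a := a)
    (fun _ _ => measurableSet_Iio.nullMeasurableSet) (fun _ _ _ => Iio_subset_Iio)
    ⟨a + 1, lt_add_one a, measure_ne_top ν _⟩
  rw [hInter] at htendsto
  exact (ENNReal.tendsto_toReal (measure_ne_top ν _)).comp htendsto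

theorem exists_stieltjesMeasure_eq {ν : Measure ℝ} [IsFiniteMeasure ν] (hν : ∀ᵐ s ∂ν, 0 ≤ s) :
    ∃ (g : ℝ → ℝ) (hg : MonotoneOn g (Ici 0)), stieltjesMeasure hg = ν := by
  have hmono : Monotone fun b => ν.real (Iio b) := fun _ _ hab =>
    measureReal_mono (Iio_subset_Iio hab)
  have hmax : (fun b => ν.real (Iio (max b 0))) = fun b => ν.real (Iio b) := by
    funext b
    refine measureReal_congr ?_
    filter_upwards [hν] with s hs
    exact propext (lt_max_iff.trans (or_iff_left hs.not_gt))
  refine ⟨fun b => ν.real (Iio b), hmono.monotoneOn _,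
    (Measure.ext_of_Ioc _ _ fun a b hab => ?_).symm⟩
  have hrightLim (a : ℝ) :
      (monotone_comp_max (hmono.monotoneOn (Ici 0))).stieltjesFunction a = ν.real (Iic a) := by
    rw [Monotone.stieltjesFunction_eq, hmax]
    exact rightLim_eq_of_tendsto (tendsto_measureReal_Iio_nhdsGT ν a)
  rw [stieltjesMeasure, StieltjesFunction.measure_Ioc, hrightLim, hrightLim,
    ← measureReal_sdiff (Iic_subset_Iic.2 hab.le) measurableSet_Iic, Iic_sdiff_Iic,
    ofReal_measureReal]

theorem exists_stieltjesMeasure_integral_iff_exists_measure {α : ℝ} (hα : -1 / 2 ≤ α) (f : ℝ → ℝ) :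
    (∃ (g : ℝ → ℝ) (hg : MonotoneOn g (Ici 0)), ∀ x, 0 ≤ x →
        IntegrableOn (fun y => besselKernel α (x * y)) (Ici 0) (stieltjesMeasure hg) ∧
        f x = ∫ y in Ici 0, besselKernel α (x * y) ∂stieltjesMeasure hg) ↔
      ∃ ν : Measure ℝ, IsFiniteMeasure ν ∧ (∀ᵐ s ∂ν, 0 ≤ s) ∧ EqOn f (hankel α ν 1) (Ici 0) := by
  have hα' : -1 < α := by linarith
  have hkernel {x : ℝ} (hx : 0 ≤ x) : EqOn (fun y => besselKernel α (x * y))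
      (fun y => besselSeries α (y * x) * 1) (Ici 0) := fun y hy => by
    simp only [mul_one, mul_comm y, besselKernel_eq_besselSeries (mul_nonneg hx hy)]
  constructor
  · rintro ⟨g, hg, h⟩
    refine ⟨(stieltjesMeasure hg).restrict (Ici 0), ?_, ae_restrict_mem measurableSet_Ici,
      fun x hx => (h x hx).2.trans (setIntegral_congr_fun measurableSet_Ici (hkernel hx))⟩
    have hconst := (h 0 le_rfl).1
    simp only [zero_mul, besselKernel, if_true] at hconst
    exact (integrable_const_iff_isFiniteMeasure
      (one_div_ne_zero (Gamma_pos_of_pos (by linarith)).ne')).1 hconst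
  · rintro ⟨ν, _, hν, hfν⟩
    obtain ⟨g, hg, rfl⟩ := exists_stieltjesMeasure_eq hν
    refine ⟨g, hg, fun x hx => ⟨?_, ?_⟩⟩
    · exact (integrable_besselSeries_mul hα hν (integrable_const 1) hx).integrableOn.congr_fun
        (hkernel hx).symm measurableSet_Ici
    · rw [hfν hx, setIntegral_congr_fun measurableSet_Ici (hkernel hx),
        Measure.restrict_eq_self_of_ae_mem (s := Ici 0) hν]
      rfl

end Stieltjes

theorem integrableOn_mul_rpow_of_decay {α C ε : ℝ} {f : ℝ → ℝ} (hα : -1 < α) (hε : 0 < ε)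
    (hfc : ContinuousOn f (Ici 0))
    (hf : ∀ x, 0 ≤ x → |f x| ≤ C * (1 + |x|) ^ (-α - 1 - ε)) :
    IntegrableOn (fun x => f x * x ^ α) (Ioi 0) := by
  have htop : f =O[atTop] (· ^ (-(α + 1 + ε))) := by
    refine .of_bound |C| ((eventually_gt_atTop 0).mono fun x hx => ?_)
    have hle : (1 + |x|) ^ (-α - 1 - ε) ≤ x ^ (-(α + 1 + ε)) := by
      rw [abs_of_pos hx, show -α - 1 - ε = -(α + 1 + ε) by ring]
      exact rpow_le_rpow_of_nonpos hx (by linarith) (by linarith)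
    rw [norm_of_nonneg (rpow_nonneg hx.le _)]
    exact (hf x hx.le).trans (mul_le_mul (le_abs_self C) hle (by positivity) (abs_nonneg C))
  have hbot : f =O[𝓝[>] 0] (· ^ (-0 : ℝ)) := by
    simp only [neg_zero, rpow_zero]
    exact ((hfc 0 self_mem_Ici).mono Ioi_subset_Ici_self).isBigO_one ℝ
  have hmellin := mellin_convergent_of_isBigO_scalar (s := α + 1)
    ((hfc.mono Ioi_subset_Ici_self).locallyIntegrableOn measurableSet_Ioi) htop (by linarith)
    hbot (by linarith)
  simpa only [add_sub_cancel_right, mul_comm] using hmellin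

theorem proposition2p9_general {α : ℝ} {f : ℝ → ℝ} (hα : -1 / 2 ≤ α) (hfc : ContinuousOn f (Ici 0))
    (hf : IntegrableOn (fun x => f x * x ^ α) (Ioi 0)) :
    (∀ y, 0 < y → ∀ j, 0 ≤ laguerreCoeff α (fun x => f (x / y)) j) ↔
      ∃ (g : ℝ → ℝ) (hg : MonotoneOn g (Ici 0)), ∀ x, 0 ≤ x →
        IntegrableOn (fun y => besselKernel α (x * y)) (Ici 0) (stieltjesMeasure hg) ∧
        f x = ∫ y in Ici 0, besselKernel α (x * y) ∂stieltjesMeasure hg :=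
  (forall_laguerreCoeff_nonneg_iff_exists_measure hα hfc (integrable_rpowMeasure_iff.2 hf)).trans
    (exists_stieltjesMeasure_integral_iff_exists_measure hα f).symm

end SILP

end

theorem proposition2p9 (α : ℝ) (hα : -1 / 2 < α) (f : ℝ → ℝ)
    (hf : ContinuousOn f (Set.Ici 0))
    (hdecay : ∃ C : ℝ, 0 < C ∧ ∃ ε : ℝ, 0 < ε ∧
      ∀ x, 0 ≤ x → |f x| ≤ C * (1 + |x|) ^ (-α - 1 - ε)) :
    SILP.HasSILP α f ↔
      ∃ (g : ℝ → ℝ) (hg : MonotoneOn g (Set.Ici 0)), ∀ x, 0 ≤ x →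
        MeasureTheory.IntegrableOn (fun y => SILP.besselKernel α (x * y)) (Set.Ici 0)
          (SILP.stieltjesMeasure hg) ∧
        f x = ∫ y in Set.Ici (0 : ℝ), SILP.besselKernel α (x * y) ∂(SILP.stieltjesMeasure hg) := by
  obtain ⟨C, hC, ε, hε, hb⟩ := hdecay
  exact (and_iff_right ⟨hf, ε, hε, C, hC, hb⟩).trans (SILP.proposition2p9_general hα.le hf
    (SILP.integrableOn_mul_rpow_of_decay (by linarith) hε hf hb))
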